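/- A $t$-query quantum decision tree on $n$-bit inputs ($n\ge 1$) is given by real orthogonal matrices $U_0,\dots,U_t$ on a query register with basis states indexed by the $n$ positions, a one-bit answer register and a finite-dimensional work register; on input $x\in\{0,1\}^n$ its output is the result of measuring $U_tO_xU_{t-1}\cdots O_xU_1O_xU_0|0\rangle|0\rangle|0\rangle$ in the computational basis, where $O_x|i\rangle|b\rangle|z\rangle=|i\rangle|b\oplus x_i\rangle|z\rangle$. A hybrid decision tree is a finite rooted tree whose internal nodes carry quantum decision trees, with one child for each measurement outcome, and whose leaves are labelled by output values; it is evaluated by starting at the root, running the quantum decision tree of the current node on $x$, moving to the child of the observed outcome, and outputting the label of the leaf that is reached. Its cost is the maximum over root-to-leaf paths of the total number of queries made by the quantum decision trees on the path. It is $q$-limited if each of its quantum decision trees makes at most $q$ queries, and it computes a partial function $f:D\to\{0,1\}$, $D\subseteq\{0,1\}^n$, if for every $x\in D$ it outputs $f(x)$ with probability at least $2/3$. Let $H_q(f)$ be the minimal cost of a $q$-limited hybrid decision tree that computes $f$, and let $\mathrm{PartialOr}_n$ be the OR function on $n$ bits restricted to the inputs of Hamming weight at most $1$. **Theorem.** $H_q(\mathrm{PartialOr}_n)=\Theta(n/q+\sqrt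 n)$, uniformly in $q$: there are absolute constants $c,C>0$ such that for all integers $n\ge 1$ and $q\ge 1$, $$c\left(\frac nq+\sqrt n\right)\;\le\; H_q(\mathrm{PartialOr}_n)\;\le\; C\left(\frac nq+\sqrt n\right).$$ -/

import Mathlib

open scoped Matrix

/-- Labels of the computational basis on an `n`-bit input: query register, answer register and a
work register of dimension `w + 1`. -/
abbrev Reg (n w : ℕ) : Type := Fin n × Bool × Fin (w + 1)

/-- The query operator `O_x : |i⟩|b⟩|z⟩ ↦ |i⟩|b ⊕ x_i⟩|z⟩` acting on vectors of (real) amplitudes.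
The map on basis labels is an involution, so amplitudes are transported by the same formula. -/
def queryOp {n w : ℕ} (x : Fin n → Bool) (ψ : Reg n w → ℝ) : Reg n w → ℝ :=
  fun p => ψ (p.1, xor p.2.1 (x p.1), p.2.2)

/-- The action of the query operator on computational basis vectors. -/
theorem queryOp_single {n w : ℕ} (x : Fin n → Bool) (i : Fin n) (b : Bool) (z : Fin (w + 1)) :
    queryOp x (Pi.single (i, b, z) (1 : ℝ)) = Pi.single (i, xor b (x i), z) 1 := by
  funext p
  obtain ⟨j, c, y⟩ := p
  simp only [queryOp, Pi.single_apply, Prod.mk.injEq]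
  congr 1
  apply propext
  constructor
  · rintro ⟨rfl, h, rfl⟩
    refine ⟨rfl, ?_, rfl⟩
    rw [← h]
    simp
  · rintro ⟨rfl, h, rfl⟩
    refine ⟨rfl, ?_, rfl⟩
    rw [h]
    simp

/-- A quantum decision tree on `n`-bit inputs with real amplitudes: the first unitary `U₀` and
the list `U₁, …, U_t` of the unitaries that follow the `t` queries. -/
structure QuantumTree (n : ℕ) where
  /-- The work register has dimension `work + 1`. -/
  work : ℕ
  /-- The unitary `U₀`. -/
  first : Matrix.orthogonalGroup (Reg n work) ℝ
  /-- The unitaries `U₁, …, U_t`. -/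
  steps : List (Matrix.orthogonalGroup (Reg n work) ℝ)

namespace QuantumTree

variable {n : ℕ}

/-- The number of queries `t`. -/
def queries (A : QuantumTree n) : ℕ := A.steps.length

/-- The initial state `|0⟩|0⟩|0⟩`. -/
def initState [NeZero n] (A : QuantumTree n) : Reg n A.work → ℝ :=
  Pi.single (0, false, 0) 1

/-- The final state `U_t O_x U_{t-1} O_x ⋯ O_x U₁ O_x U₀ |0⟩|0⟩|0⟩`. -/
def finalState [NeZero n] (A : QuantumTree n) (x : Fin n → Bool) : Reg n A.work → ℝ :=
  A.steps.foldl (fun ψ U => U.1 *ᵥ queryOp x ψ) (A.first.1 *ᵥ A.initState)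

/-- The probability of the outcome `p` when the final state is measured in the computational
basis. -/
def outcomeProb [NeZero n] (A : QuantumTree n) (x : Fin n → Bool) (p : Reg n A.work) : ℝ :=
  A.finalState x p ^ 2

end QuantumTree

/-- A hybrid decision tree on `n`-bit inputs: a leaf carries an output value, an internal node
carries a quantum decision tree and has one child for each of its measurement outcomes. -/
inductive HybridTree (n : ℕ) : Type
  | leaf (value : Bool) : HybridTree n
  | node (A : QuantumTree n) (child : Reg n A.work → HybridTree n) : HybridTree n

namespace HybridTree

variable {n : ℕ}

/-- The maximum over all root-to-leaf paths of the total number of queries made by the quantum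
decision trees on the path. -/
def cost : HybridTree n → ℕ
  | leaf _ => 0
  | node A child => A.queries + Finset.univ.sup fun p => (child p).cost

/-- Every quantum decision tree in the hybrid tree makes at most `q` queries. -/
def Limited (q : ℕ) : HybridTree n → Prop
  | leaf _ => True
  | node A child => A.queries ≤ q ∧ ∀ p, (child p).Limited q

/-- The probability that evaluating the tree on input `x` ends in a leaf with value `b`. -/
def outputProb [NeZero n] (x : Fin n → Bool) (b : Bool) : HybridTree n → ℝ
  | leaf c => if c = b then 1 else 0
  | node A child => ∑ p, A.outcomeProb x p * (child p).outputProb x b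

/-- The tree computes the partial Boolean function `f : D → {0,1}` with error at most `1/3`. -/
def Computes [NeZero n] (T : HybridTree n) {D : Set (Fin n → Bool)} (f : D → Bool) : Prop :=
  ∀ x : D, 2 / 3 ≤ T.outputProb (x : Fin n → Bool) (f x)

end HybridTree

/-- The `q`-limited hybrid query complexity of a partial Boolean function: the minimal cost of a
`q`-limited hybrid decision tree that computes it. -/
noncomputable def hybridComplexity {n : ℕ} [NeZero n] {D : Set (Fin n → Bool)} (f : D → Bool)
    (q : ℕ) : ℕ :=
  sInf {c : ℕ | ∃ T : HybridTree n, T.Limited q ∧ T.Computes f ∧ T.cost = c}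

/-- The `n`-bit strings of Hamming weight at most one. -/
def partialOrDomain (n : ℕ) : Set (Fin n → Bool) :=
  {x | (Finset.univ.filter fun i => x i = true).card ≤ 1}

/-- The OR function restricted to the strings of Hamming weight at most one. -/
def partialOr (n : ℕ) (x : partialOrDomain n) : Bool :=
  decide (∃ i, x.1 i = true)

/-! Lower bound. For one quantum tree with `t` queries, the hybrid argument bounds by `4 t²` the
squared distance between the final states on the zero input and on a unit input, summed over all
unit inputs. In a hybrid tree, follow the random path taken on the zero input and add up these
distances. Since that path does not depend on the unit input, the sum over unit inputs can be moved
inside the expectation; with `t² ≤ q t` at each node, the total is at most `4 q · cost`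
(`sum_one_sub_closeness_le`). Conversely, `max_closeness_sq_le_affinity` shows that a small expected
distance forces a large Bhattacharyya coefficient of the outputs, so correctness costs a constant
for each of the `n` unit inputs. Hence `n ≤ 1296 q · cost`. Every tree is limited by its own cost,
so also `n ≤ 1296 cost²`, which gives the `√n` term.

Upper bound. Grover search with `t ≲ √n` queries never errs on the zero input and detects a marked
position with probability at least `t²/n`. Repeating it about `2n/t²` times costs `O(n/t + t)`; take
`t` to be the minimum of `q` and about `√n/2`. -/

/-! ### The hybrid argument for a single quantum tree -/

theorem sum_mulVec_sq {ι : Type*} [Fintype ι] [DecidableEq ι] (U : Matrix.orthogonalGroup ι ℝ)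
    (v : ι → ℝ) : ∑ p, (U.1 *ᵥ v) p ^ 2 = ∑ p, v p ^ 2 := by
  have h : (U.1 *ᵥ v) ⬝ᵥ (U.1 *ᵥ v) = v ⬝ᵥ v := by
    rw [Matrix.dotProduct_mulVec, ← Matrix.mulVec_transpose, Matrix.mulVec_mulVec]
    have := (Matrix.mem_orthogonalGroup_iff' ι ℝ).1 U.2
    rw [this, Matrix.one_mulVec]
  simpa [dotProduct, sq] using h

/-- Flipping the answer register on the positions where `x` is `true`. -/
def queryEquiv {n : ℕ} (w : ℕ) (x : Fin n → Bool) : Equiv.Perm (Reg n w) where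
  toFun p := (p.1, xor p.2.1 (x p.1), p.2.2)
  invFun p := (p.1, xor p.2.1 (x p.1), p.2.2)
  left_inv p := by simp
  right_inv p := by simp

theorem sum_queryOp_sq {n w : ℕ} (x : Fin n → Bool) (ψ : Reg n w → ℝ) :
    ∑ p, queryOp x ψ p ^ 2 = ∑ p, ψ p ^ 2 :=
  Equiv.sum_comp (queryEquiv w x) fun p => ψ p ^ 2

theorem queryOp_sub {n w : ℕ} (x : Fin n → Bool) (ψ φ : Reg n w → ℝ) :
    queryOp x (ψ - φ) = queryOp x ψ - queryOp x φ := rfl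

theorem queryOp_const_false {n w : ℕ} (ψ : Reg n w → ℝ) : queryOp (fun _ => false) ψ = ψ := by
  funext p
  simp [queryOp]

/-- The input whose only nonzero bit is at position `j`. -/
def unitInput {n : ℕ} (j : Fin n) : Fin n → Bool := fun i => decide (i = j)

/-- The queries to different unit inputs alter disjoint blocks of coordinates, so together they
displace `φ` exactly as much as the query to the all-ones input, by at most `2 ‖φ‖`. -/
theorem sum_queryOp_unitInput_sub_sq_le {n w : ℕ} (φ : Reg n w → ℝ) :
    ∑ j, ∑ p, (queryOp (unitInput j) φ p - φ p) ^ 2 ≤ 4 * ∑ p, φ p ^ 2 := by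
  have h1 : ∀ p : Reg n w, ∑ j, (queryOp (unitInput j) φ p - φ p) ^ 2 =
      (queryOp (fun _ => true) φ p - φ p) ^ 2 := by
    intro p
    rw [Finset.sum_eq_single p.1]
    · simp [queryOp, unitInput]
    · intro j _ hj
      simp [queryOp, unitInput, Ne.symm hj]
    · simp
  rw [Finset.sum_comm, Finset.sum_congr rfl fun p _ => h1 p]
  have h2 := sum_queryOp_sq (fun _ => true) φ
  calc ∑ p, (queryOp (fun _ => true) φ p - φ p) ^ 2
      ≤ ∑ p, (2 * queryOp (fun _ => true) φ p ^ 2 + 2 * φ p ^ 2) :=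
        Finset.sum_le_sum fun p _ => by
          nlinarith [sq_nonneg (queryOp (fun _ => true) φ p + φ p)]
    _ = 4 * ∑ p, φ p ^ 2 := by
        rw [Finset.sum_add_distrib, ← Finset.mul_sum, ← Finset.mul_sum, h2]
        ring

theorem sum_add_sq_le {ι : Type*} [Fintype ι] (f g : ι → ℝ) {a b : ℝ} (ha : 0 ≤ a) (hb : 0 ≤ b)
    (hf : ∑ i, f i ^ 2 ≤ a ^ 2) (hg : ∑ i, g i ^ 2 ≤ b ^ 2) :
    ∑ i, (f i + g i) ^ 2 ≤ (a + b) ^ 2 := by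
  have h1 : (∑ i, f i * g i) ^ 2 ≤ (a * b) ^ 2 := by
    rw [mul_pow]
    exact (Finset.sum_mul_sq_le_sq_mul_sq _ _ _).trans
      (mul_le_mul hf hg (Finset.sum_nonneg fun i _ => sq_nonneg _) (sq_nonneg _))
  have h2 := abs_le_of_sq_le_sq' h1 (mul_nonneg ha hb)
  have h3 : ∑ i, (f i + g i) ^ 2 = ∑ i, f i ^ 2 + 2 * ∑ i, f i * g i + ∑ i, g i ^ 2 := by
    rw [Finset.mul_sum, ← Finset.sum_add_distrib, ← Finset.sum_add_distrib]
    exact Finset.sum_congr rfl fun i _ => by ring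
  rw [h3]
  nlinarith [h2.2]

theorem sum_sum_add_sq_le {ι κ : Type*} [Fintype ι] [Fintype κ] (f g : ι → κ → ℝ) {a b : ℝ}
    (ha : 0 ≤ a) (hb : 0 ≤ b) (hf : ∑ i, ∑ k, f i k ^ 2 ≤ a ^ 2)
    (hg : ∑ i, ∑ k, g i k ^ 2 ≤ b ^ 2) : ∑ i, ∑ k, (f i k + g i k) ^ 2 ≤ (a + b) ^ 2 := by
  rw [← Fintype.sum_prod_type'] at *
  exact sum_add_sq_le (fun i : ι × κ => f i.1 i.2) (fun i => g i.1 i.2) ha hb hf hg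

/-- The deviations for all `j` form one vector in a direct sum. Orthogonal steps preserve its norm,
and by the triangle inequality each query adds at most `2`. The parameter `k` counts the queries
already made. -/
theorem sum_foldl_sub_sq_le {n w : ℕ} (L : List (Matrix.orthogonalGroup (Reg n w) ℝ)) :
    ∀ (k : ℕ) (φ : Reg n w → ℝ) (χ : Fin n → Reg n w → ℝ), ∑ p, φ p ^ 2 = 1 →
      ∑ j, ∑ p, (χ j p - φ p) ^ 2 ≤ (2 * (k : ℝ)) ^ 2 →
      ∑ j, ∑ p, (L.foldl (fun ψ U => U.1 *ᵥ queryOp (unitInput j) ψ) (χ j) p -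
        L.foldl (fun ψ U => U.1 *ᵥ queryOp (fun _ => false) ψ) φ p) ^ 2 ≤
        (2 * ((k + L.length : ℕ) : ℝ)) ^ 2 := by
  induction L with
  | nil => intro k φ χ _ h; simpa using h
  | cons U L ih =>
    intro k φ χ hφ h
    have key := ih (k + 1) (U.1 *ᵥ queryOp (fun _ => false) φ)
      (fun j => U.1 *ᵥ queryOp (unitInput j) (χ j))
      (by rw [sum_mulVec_sq, sum_queryOp_sq, hφ]) ?_
    · have e : k + (U :: L).length = k + 1 + L.length := by simp; omega
      rw [e]
      exact key
    · have h1 : ∀ j, ∑ p, ((U.1 *ᵥ queryOp (unitInput j) (χ j)) p -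
          (U.1 *ᵥ queryOp (fun _ => false) φ) p) ^ 2 =
          ∑ p, (queryOp (unitInput j) (χ j - φ) p + (queryOp (unitInput j) φ p - φ p)) ^ 2 := by
        intro j
        have := sum_mulVec_sq U (queryOp (unitInput j) (χ j) - queryOp (fun _ => false) φ)
        rw [Matrix.mulVec_sub, queryOp_const_false] at this
        rw [queryOp_const_false]
        simp only [Pi.sub_apply] at this
        rw [this, queryOp_sub]
        exact Finset.sum_congr rfl fun p _ => by simp
      rw [Finset.sum_congr rfl fun j _ => h1 j]
      have h2 := sum_sum_add_sq_le
        (fun j p => queryOp (unitInput j) (χ j - φ) p)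
        (fun j p => queryOp (unitInput j) φ p - φ p)
        (a := 2 * k) (b := 2) (by positivity) (by norm_num) ?_ ?_
      · refine h2.trans (le_of_eq ?_)
        push_cast
        ring
      · refine le_trans (le_of_eq ?_) h
        exact Finset.sum_congr rfl fun j _ => sum_queryOp_sq _ _
      · refine (sum_queryOp_unitInput_sub_sq_le φ).trans ?_
        rw [hφ]
        norm_num

theorem sum_foldl_sq {n w : ℕ} (x : Fin n → Bool)
    (L : List (Matrix.orthogonalGroup (Reg n w) ℝ)) :
    ∀ ψ : Reg n w → ℝ,
      ∑ p, L.foldl (fun ψ U => U.1 *ᵥ queryOp x ψ) ψ p ^ 2 = ∑ p, ψ p ^ 2 := by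
  induction L with
  | nil => intro ψ; rfl
  | cons U L ih =>
    intro ψ
    rw [List.foldl_cons, ih, sum_mulVec_sq, sum_queryOp_sq]

namespace QuantumTree

variable {n : ℕ} [NeZero n] (A : QuantumTree n)

theorem sum_initState_sq : ∑ p, A.initState p ^ 2 = 1 := by
  simp [initState, Pi.single_apply]

theorem sum_outcomeProb (x : Fin n → Bool) : ∑ p, A.outcomeProb x p = 1 := by
  unfold outcomeProb finalState
  rw [sum_foldl_sq, sum_mulVec_sq, sum_initState_sq]

theorem outcomeProb_nonneg (x : Fin n → Bool) (p : Reg n A.work) : 0 ≤ A.outcomeProb x p :=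
  sq_nonneg _

/-- The hybrid argument: `t` queries separate the final state on the zero input from those on the
unit inputs by a total squared distance of at most `4 t²`. -/
theorem sum_finalState_sub_sq_le :
    ∑ j, ∑ p, (A.finalState (fun _ => false) p - A.finalState (unitInput j) p) ^ 2 ≤
      4 * (A.queries : ℝ) ^ 2 := by
  have h := sum_foldl_sub_sq_le A.steps 0 (A.first.1 *ᵥ A.initState)
    (fun _ => A.first.1 *ᵥ A.initState) (by rw [sum_mulVec_sq, sum_initState_sq]) (by simp)
  calc _ = _ := Finset.sum_congr rfl fun j _ => Finset.sum_congr rfl fun p _ => sub_sq_comm _ _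
    _ ≤ _ := h
    _ = _ := by rw [zero_add]; unfold queries; ring

end QuantumTree

/-! ### From distance along a path to distance of outputs -/

/-- Pointwise form of the induction step of `max_closeness_sq_le_affinity`: `a`, `b` are absolute
amplitudes of one outcome on the two inputs, `t` and `u` the closeness at the node and at the child.
The last term vanishes when summed over outcomes. -/
theorem two_mul_sq_mul_le {a b t u : ℝ} (ha : 0 ≤ a) (hb : 0 ≤ b) (ht0 : 0 ≤ t) (ht1 : t ≤ 1)
    (hu1 : u ≤ 1) :
    2 * t * (a ^ 2 * u) ≤ a * b * u ^ 2 + t ^ 2 * a ^ 2 + 9 / 2 * t * (a - b) ^ 2 +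
      t ^ 2 / 2 * (a ^ 2 - b ^ 2) := by
  -- The right side minus the left side of the goal is this form plus `t (1 - t) (a - b)² / 2`. If
  -- `b ≥ a / 2`, complete the square; otherwise `a (u - t) ≤ a ≤ 2 (a - b)`, so the last term
  -- absorbs the cross term.
  have key : 0 ≤ a * b * (u - t) ^ 2 - 2 * t * a * (a - b) * (u - t) + 4 * t * (a - b) ^ 2 := by
    rcases le_total (a / 2) b with h | h
    · have h1 : a * (a / 2) * (u - t) ^ 2 ≤ a * b * (u - t) ^ 2 := by gcongr
      nlinarith [sq_nonneg (a * (u - t) - 2 * t * (a - b)),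
        mul_nonneg (mul_nonneg ht0 (by linarith : 0 ≤ 2 - t)) (sq_nonneg (a - b))]
    · have h1 : 0 ≤ a * b * (u - t) ^ 2 := by positivity
      have h2 : 0 ≤ a - b := by linarith
      have h3 : a * (u - t) ≤ a * 1 := by gcongr; linarith
      nlinarith [mul_nonneg (mul_nonneg ht0 h2)
        (by linarith : 0 ≤ 4 * (a - b) - 2 * (a * (u - t)))]
  nlinarith [mul_nonneg (mul_nonneg ht0 (by linarith : 0 ≤ 1 - t)) (sq_nonneg (a - b))]

namespace HybridTree

theorem Limited.mono {n q r : ℕ} (hqr : q ≤ r) : ∀ {T : HybridTree n}, T.Limited q → T.Limited r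
  | leaf _, _ => trivial
  | node _ _, h => ⟨h.1.trans hqr, fun p => (h.2 p).mono hqr⟩

theorem limited_cost {n : ℕ} : ∀ T : HybridTree n, T.Limited T.cost
  | leaf _ => trivial
  | node A child => by
    refine ⟨by rw [cost]; exact Nat.le_add_right _ _, fun p => (limited_cost (child p)).mono ?_⟩
    rw [cost]
    exact (Finset.le_sup (f := fun p => (child p).cost) (Finset.mem_univ p)).trans
      (Nat.le_add_left _ _)

variable {n : ℕ} [NeZero n]

theorem outputProb_nonneg (x : Fin n → Bool) (b : Bool) :
    ∀ T : HybridTree n, 0 ≤ T.outputProb x b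
  | leaf c => by unfold outputProb; split_ifs <;> norm_num
  | node A child => by
    unfold outputProb
    exact Finset.sum_nonneg fun p _ =>
      mul_nonneg (A.outcomeProb_nonneg x p) (outputProb_nonneg x b (child p))

theorem outputProb_true_add_false (x : Fin n → Bool) :
    ∀ T : HybridTree n, T.outputProb x true + T.outputProb x false = 1
  | leaf c => by cases c <;> simp [outputProb]
  | node A child => by
    unfold outputProb
    rw [← Finset.sum_add_distrib, ← A.sum_outcomeProb x]
    refine Finset.sum_congr rfl fun p _ => ?_
    rw [← mul_add, outputProb_true_add_false x (child p), mul_one]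

/-- The Bhattacharyya coefficient of the output distributions on two inputs. -/
noncomputable def affinity (x y : Fin n → Bool) (T : HybridTree n) : ℝ :=
  ∑ b, √(T.outputProb x b) * √(T.outputProb y b)

theorem affinity_nonneg (x y : Fin n → Bool) (T : HybridTree n) : 0 ≤ T.affinity x y :=
  Finset.sum_nonneg fun _ _ => by positivity

/-- Cauchy–Schwarz over the outcomes: forgetting which child was visited can only increase the
affinity. -/
theorem le_affinity_node (x y : Fin n → Bool) (A : QuantumTree n)
    (child : Reg n A.work → HybridTree n) :
    ∑ p, |A.finalState x p| * |A.finalState y p| * (child p).affinity x y ≤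
      (node A child).affinity x y := by
  unfold affinity
  simp only [Finset.mul_sum]
  rw [Finset.sum_comm]
  refine Finset.sum_le_sum fun b _ => ?_
  have h := Real.sum_sqrt_mul_sqrt_le Finset.univ
    (f := fun p => A.outcomeProb x p * (child p).outputProb x b)
    (g := fun p => A.outcomeProb y p * (child p).outputProb y b)
    (fun p => mul_nonneg (A.outcomeProb_nonneg x p) (outputProb_nonneg x b _))
    (fun p => mul_nonneg (A.outcomeProb_nonneg y p) (outputProb_nonneg y b _))
  refine le_trans (le_of_eq (Finset.sum_congr rfl fun p _ => ?_)) h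
  rw [Real.sqrt_mul (A.outcomeProb_nonneg x p), Real.sqrt_mul (A.outcomeProb_nonneg y p)]
  unfold QuantumTree.outcomeProb
  rw [Real.sqrt_sq_eq_abs, Real.sqrt_sq_eq_abs]
  ring

/-- One minus (a multiple of) the expected total squared distance, over the path followed on input
`x`, between the final states on the inputs `x` and `y`. -/
noncomputable def closeness (x y : Fin n → Bool) : HybridTree n → ℝ
  | leaf _ => 1
  | node A child => ∑ p, A.outcomeProb x p * closeness x y (child p) -
      9 / 4 * ∑ p, (A.finalState x p - A.finalState y p) ^ 2

theorem closeness_le_one (x y : Fin n → Bool) : ∀ T : HybridTree n, T.closeness x y ≤ 1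
  | leaf _ => le_rfl
  | node A child => by
    unfold closeness
    have h1 : ∑ p, A.outcomeProb x p * closeness x y (child p) ≤ ∑ p, A.outcomeProb x p :=
      Finset.sum_le_sum fun p _ =>
        mul_le_of_le_one_right (A.outcomeProb_nonneg x p) (closeness_le_one x y (child p))
    have h2 : 0 ≤ ∑ p, (A.finalState x p - A.finalState y p) ^ 2 :=
      Finset.sum_nonneg fun p _ => sq_nonneg _
    rw [A.sum_outcomeProb] at h1
    linarith

/-- The truncation at `0` is needed because closeness can be negative. Summing `two_mul_sq_mul_le`
over outcomes, the `9/2 t` distance term is cancelled by the `9/4` in `closeness`, leaving `2t² ≤ ∑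
a b u² + t²`. -/
theorem max_closeness_sq_le_affinity (x y : Fin n → Bool) :
    ∀ T : HybridTree n, max (T.closeness x y) 0 ^ 2 ≤ T.affinity x y
  | leaf c => by cases c <;> simp [closeness, affinity, outputProb]
  | node A child => by
    rcases le_total ((node A child).closeness x y) 0 with h0 | h0
    · rw [max_eq_right h0]
      simpa using affinity_nonneg x y _
    rw [max_eq_left h0]
    have h1 := closeness_le_one x y (node A child)
    set t := (node A child).closeness x y with ht
    refine le_trans ?_ (le_affinity_node x y A child)
    set u : Reg n A.work → ℝ := fun p => max ((child p).closeness x y) 0 with hu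
    have hF : ∑ p, |A.finalState x p| * |A.finalState y p| * u p ^ 2 ≤
        ∑ p, |A.finalState x p| * |A.finalState y p| * (child p).affinity x y :=
      Finset.sum_le_sum fun p _ => by
        gcongr
        exact max_closeness_sq_le_affinity x y (child p)
    refine le_trans ?_ hF
    have hpt := Finset.sum_le_sum fun (p : Reg n A.work) (_ : p ∈ Finset.univ) =>
      two_mul_sq_mul_le (abs_nonneg (A.finalState x p)) (abs_nonneg (A.finalState y p)) h0 h1
        (max_le (closeness_le_one x y (child p)) zero_le_one : u p ≤ 1)
    have hx := A.sum_outcomeProb x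
    have hy := A.sum_outcomeProb y
    unfold QuantumTree.outcomeProb at hx hy
    simp only [Finset.sum_add_distrib, ← Finset.mul_sum, Finset.sum_sub_distrib, sq_abs, hx, hy]
      at hpt
    have hd : ∑ p, (|A.finalState x p| - |A.finalState y p|) ^ 2 ≤
        ∑ p, (A.finalState x p - A.finalState y p) ^ 2 :=
      Finset.sum_le_sum fun p _ => sq_le_sq.2 (abs_abs_sub_abs_le _ _)
    have hc : ∑ p, A.outcomeProb x p * closeness x y (child p) ≤
        ∑ p, A.finalState x p ^ 2 * u p :=
      Finset.sum_le_sum fun p _ =>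
        mul_le_mul_of_nonneg_left (le_max_left _ _) (A.outcomeProb_nonneg x p)
    have ht' : t = ∑ p, A.outcomeProb x p * closeness x y (child p) -
      9 / 4 * ∑ p, (A.finalState x p - A.finalState y p) ^ 2 := by rw [ht, closeness]
    nlinarith [mul_le_mul_of_nonneg_left hd h0, mul_le_mul_of_nonneg_left hc h0,
      congrArg (t * ·) ht']

/-- A node with `t` queries contributes at most `9/4 · 4 t² ≤ 9 q t`, and the children are averaged
with weights independent of `j`. -/
theorem sum_one_sub_closeness_le {q : ℕ} : ∀ T : HybridTree n, T.Limited q →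
    ∑ j, (1 - T.closeness (fun _ => false) (unitInput j)) ≤ 9 * q * T.cost
  | leaf _, _ => by simp [closeness, cost]
  | node A child, hT => by
    obtain ⟨hA, hch⟩ := hT
    set s := Finset.univ.sup fun p => (child p).cost with hs
    have ih : ∀ p, ∑ j, (1 - (child p).closeness (fun _ => false) (unitInput j)) ≤ 9 * q * s := by
      intro p
      refine (sum_one_sub_closeness_le (child p) (hch p)).trans ?_
      gcongr
      exact Finset.le_sup (f := fun p => (child p).cost) (Finset.mem_univ p)
    have h1 := A.sum_finalState_sub_sq_le
    have hA' : (A.queries : ℝ) ≤ q := by exact_mod_cast hA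
    have h2 : ∀ j, 1 - (node A child).closeness (fun _ => false) (unitInput j) =
        ∑ p, A.outcomeProb (fun _ => false) p *
          (1 - (child p).closeness (fun _ => false) (unitInput j)) +
        9 / 4 * ∑ p, (A.finalState (fun _ => false) p - A.finalState (unitInput j) p) ^ 2 := by
      intro j
      simp only [mul_sub, mul_one, Finset.sum_sub_distrib, A.sum_outcomeProb, closeness]
      ring
    have h3 : ∑ p, A.outcomeProb (fun _ => false) p *
        ∑ j, (1 - (child p).closeness (fun _ => false) (unitInput j)) ≤ 9 * q * s := by
      calc _ ≤ ∑ p, A.outcomeProb (fun _ => false) p * (9 * q * s) :=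
            Finset.sum_le_sum fun p _ =>
              mul_le_mul_of_nonneg_left (ih p) (A.outcomeProb_nonneg _ p)
        _ = 9 * q * s := by rw [← Finset.sum_mul, A.sum_outcomeProb, one_mul]
    have hc : ((node A child).cost : ℝ) = A.queries + s := by
      rw [cost, Nat.cast_add]
    rw [Finset.sum_congr rfl fun j _ => h2 j, Finset.sum_add_distrib, ← Finset.mul_sum,
      Finset.sum_comm, hc]
    simp only [← Finset.mul_sum]
    nlinarith [mul_le_mul_of_nonneg_right hA' (Nat.cast_nonneg' A.queries : (0 : ℝ) ≤ A.queries)]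

theorem closeness_le_of_separated {x y : Fin n → Bool} {T : HybridTree n}
    (hx : 2 / 3 ≤ T.outputProb x false) (hy : 2 / 3 ≤ T.outputProb y true) :
    T.closeness x y ≤ 1 - 1 / 144 := by
  have hx1 := T.outputProb_true_add_false x
  have hy1 := T.outputProb_true_add_false y
  have h := max_closeness_sq_le_affinity x y T
  have hp := Real.sq_sqrt (outputProb_nonneg x true T)
  have hp' := Real.sq_sqrt (outputProb_nonneg x false T)
  have hq := Real.sq_sqrt (outputProb_nonneg y true T)
  have hq' := Real.sq_sqrt (outputProb_nonneg y false T)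
  unfold affinity at h
  rw [Fintype.sum_bool] at h
  have p0 := Real.sqrt_nonneg (T.outputProb x true)
  have q0 := Real.sqrt_nonneg (T.outputProb y true)
  have p1 : √(T.outputProb x true) ≤ 1 :=
    Real.sqrt_le_one.2 (by linarith [outputProb_nonneg x false T])
  have q1 : √(T.outputProb y true) ≤ 1 :=
    Real.sqrt_le_one.2 (by linarith [outputProb_nonneg y false T])
  set p := √(T.outputProb x true)
  set p' := √(T.outputProb x false)
  set q := √(T.outputProb y true)
  set q' := √(T.outputProb y false)
  -- `q² - p² ≥ 1/3` and `q + p ≤ 2`. The affinity is `1 - ((p - q)² + (p' - q')²) / 2 ≤ 1 - 1/72 <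
  -- (1 - 1/144)²`.
  have hd : 1 / 6 ≤ q - p := by
    by_contra! hlt
    nlinarith
  have h2 : (1 / 6) ^ 2 ≤ (q - p) ^ 2 := by gcongr
  by_contra! hlt
  have h3 : (1 - 1 / 144 : ℝ) ^ 2 ≤ max (T.closeness x y) 0 ^ 2 := by
    gcongr
    exact hlt.le.trans (le_max_left _ _)
  nlinarith [sq_nonneg (p' - q')]

/-- A `q`-limited hybrid tree computing `PartialOr_n` has cost at least `n / (1296 q)`. -/
theorem Computes.le_mul_cost {q : ℕ} {T : HybridTree n} (hT : T.Limited q)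
    (hc : T.Computes (partialOr n)) : (n : ℝ) ≤ 1296 * (q * T.cost) := by
  have h0 := hc ⟨fun _ => false, by simp [partialOrDomain]⟩
  have h0' : partialOr n ⟨fun _ => false, by simp [partialOrDomain]⟩ = false := by
    simp [partialOr]
  rw [h0'] at h0
  have hj : ∀ j, 1 / 144 ≤ 1 - T.closeness (fun _ => false) (unitInput j) := by
    intro j
    have hm : unitInput j ∈ partialOrDomain n := by
      simp [partialOrDomain, unitInput, Finset.filter_eq']
    have h1 := hc ⟨unitInput j, hm⟩
    have h1' : partialOr n ⟨unitInput j, hm⟩ = true := by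
      simp [partialOr, unitInput]
    rw [h1'] at h1
    linarith [closeness_le_of_separated h0 h1]
  have h2 : ∑ _j : Fin n, (1 / 144 : ℝ) ≤ _ := Finset.sum_le_sum fun j _ => hj j
  have h3 := sum_one_sub_closeness_le T hT
  simp only [Finset.sum_const, Finset.card_univ, Fintype.card_fin, nsmul_eq_mul] at h2
  linarith

end HybridTree

/-! ### Reflections and Grover search -/

/-- The reflection that fixes the unit vector `v` and negates its orthogonal complement. -/
def reflectionMatrix {ι : Type*} [Fintype ι] [DecidableEq ι] (v : ι → ℝ) (hv : v ⬝ᵥ v = 1) :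
    Matrix.orthogonalGroup ι ℝ :=
  ⟨(2 : ℝ) • Matrix.vecMulVec v v - 1, by
    rw [Matrix.mem_orthogonalGroup_iff, Matrix.transpose_sub, Matrix.transpose_smul,
      Matrix.transpose_vecMulVec, Matrix.transpose_one]
    have h : Matrix.vecMulVec v v * Matrix.vecMulVec v v = Matrix.vecMulVec v v := by
      rw [Matrix.vecMulVec_mul_vecMulVec, hv]
      simp
    simp only [sub_mul, mul_sub, smul_mul_assoc, mul_smul_comm, h, mul_one, one_mul]
    module⟩

theorem reflectionMatrix_mulVec {ι : Type*} [Fintype ι] [DecidableEq ι] (v : ι → ℝ)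
    (hv : v ⬝ᵥ v = 1) (φ : ι → ℝ) :
    (reflectionMatrix v hv).1 *ᵥ φ = (2 * (v ⬝ᵥ φ)) • v - φ := by
  simp only [reflectionMatrix, Matrix.sub_mulVec, Matrix.smul_mulVec, Matrix.vecMulVec_mulVec,
    Matrix.one_mulVec]
  simp [mul_smul]

/-- Two unit vectors that are not opposite are exchanged by a reflection. -/
theorem exists_orthogonal_swap {ι : Type*} [Fintype ι] [DecidableEq ι] (u v : ι → ℝ)
    (hu : u ⬝ᵥ u = 1) (hv : v ⬝ᵥ v = 1) (huv : 0 ≤ u ⬝ᵥ v) :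
    ∃ H : Matrix.orthogonalGroup ι ℝ, H.1 *ᵥ u = v ∧ ∀ φ, u ⬝ᵥ (H.1 *ᵥ φ) = v ⬝ᵥ φ := by
  -- Reflect about the normalised sum of `u` and `v`, whose squared length is `2 + 2k`.
  set k := u ⬝ᵥ v with hk
  have hk' : v ⬝ᵥ u = k := dotProduct_comm _ _
  set c := (√(2 + 2 * k))⁻¹ with hc
  have hc2 : c * c * (2 + 2 * k) = 1 := by
    have h := Real.mul_self_sqrt (by positivity : 0 ≤ 2 + 2 * k)
    have h0 : √(2 + 2 * k) ≠ 0 := by positivity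
    have e : c * √(2 + 2 * k) = 1 := by rw [hc, inv_mul_cancel₀ h0]
    calc c * c * (2 + 2 * k) = (c * √(2 + 2 * k)) * (c * √(2 + 2 * k)) := by
          rw [mul_mul_mul_comm, h]
      _ = 1 := by rw [e, one_mul]
  have hw : (c • (u + v)) ⬝ᵥ (c • (u + v)) = 1 := by
    simp only [smul_dotProduct, dotProduct_smul, add_dotProduct, dotProduct_add, hu, hv, hk',
      ← hk, smul_eq_mul]
    linarith
  refine ⟨reflectionMatrix _ hw, ?_, fun φ => ?_⟩
  · rw [reflectionMatrix_mulVec]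
    simp only [smul_dotProduct, add_dotProduct, hu, hk', smul_eq_mul, smul_smul]
    rw [show 2 * (c * (1 + k)) * c = 1 by linarith]
    module
  · rw [reflectionMatrix_mulVec]
    simp only [smul_dotProduct, dotProduct_smul, add_dotProduct, dotProduct_add, dotProduct_sub, hu,
      ← hk, smul_eq_mul]
    linear_combination (u ⬝ᵥ φ + v ⬝ᵥ φ) * hc2

section Grover

variable {n : ℕ}

/-- `1 / √2` on `false` and `-1 / √2` on `true`. -/
noncomputable def minusAmp (b : Bool) : ℝ := if b then -(√2)⁻¹ else (√2)⁻¹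

theorem minusAmp_xor_true (b : Bool) : minusAmp (xor b true) = -minusAmp b := by
  cases b <;> simp [minusAmp]

/-- The state `v ⊗ |−⟩` with trivial work register. -/
noncomputable def phaseState (v : Fin n → ℝ) : Reg n 0 → ℝ := fun p => v p.1 * minusAmp p.2.1

theorem phaseState_dotProduct (v w : Fin n → ℝ) : phaseState v ⬝ᵥ phaseState w = v ⬝ᵥ w := by
  have h : (√2)⁻¹ * (√2)⁻¹ = (2 : ℝ)⁻¹ := by
    rw [← mul_inv, Real.mul_self_sqrt (by norm_num)]
  simp only [dotProduct, Fintype.sum_prod_type, Fintype.sum_bool, phaseState, minusAmp]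
  refine Finset.sum_congr rfl fun i _ => ?_
  simp
  linear_combination 2 * v i * w i * h

theorem phaseState_sub (v w : Fin n → ℝ) : phaseState (v - w) = phaseState v - phaseState w := by
  funext p
  simp [phaseState, sub_mul]

theorem phaseState_smul (c : ℝ) (v : Fin n → ℝ) : phaseState (c • v) = c • phaseState v := by
  funext p
  simp [phaseState, mul_assoc]

theorem queryOp_phaseState (j : Fin n) (v : Fin n → ℝ) :
    queryOp (unitInput j) (phaseState v) = phaseState (v - (2 * v j) • Pi.single j 1) := by
  funext p
  by_cases h : p.1 = j
  · simp only [queryOp, phaseState, unitInput, h, decide_true, minusAmp_xor_true, Pi.sub_apply,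
      Pi.smul_apply, Pi.single_eq_same, smul_eq_mul]
    ring
  · simp [queryOp, phaseState, unitInput, h]

/-- The uniform superposition of the `n` positions. -/
noncomputable def uniformAmp (n : ℕ) : Fin n → ℝ := fun _ => (√(n : ℝ))⁻¹

variable [NeZero n]

theorem uniformAmp_dotProduct_self : uniformAmp n ⬝ᵥ uniformAmp n = 1 := by
  have h : (n : ℝ) ≠ 0 := Nat.cast_ne_zero.2 (NeZero.ne n)
  simp only [dotProduct, uniformAmp, Finset.sum_const, Finset.card_univ, Fintype.card_fin,
    nsmul_eq_mul]
  rw [← mul_inv, Real.mul_self_sqrt (Nat.cast_nonneg n), mul_inv_cancel₀ h]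

theorem phaseState_uniformAmp_dotProduct_self :
    phaseState (uniformAmp n) ⬝ᵥ phaseState (uniformAmp n) = 1 := by
  rw [phaseState_dotProduct, uniformAmp_dotProduct_self]

variable (n) in
theorem exists_prepareUniform : ∃ H : Matrix.orthogonalGroup (Reg n 0) ℝ,
    H.1 *ᵥ Pi.single (0, false, 0) 1 = phaseState (uniformAmp n) ∧
    ∀ φ, Pi.single (0, false, 0) 1 ⬝ᵥ (H.1 *ᵥ φ) = phaseState (uniformAmp n) ⬝ᵥ φ := by
  refine exists_orthogonal_swap _ _ (by simp) phaseState_uniformAmp_dotProduct_self ?_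
  simp only [single_dotProduct, one_mul, phaseState, minusAmp, uniformAmp]
  simp only [Bool.false_eq_true, if_false]
  positivity

variable (n) in
/-- An orthogonal matrix preparing the uniform superposition from the initial state. -/
noncomputable def prepareUniform : Matrix.orthogonalGroup (Reg n 0) ℝ :=
  (exists_prepareUniform n).choose

variable (n) in
theorem prepareUniform_mulVec_single :
    (prepareUniform n).1 *ᵥ Pi.single (0, false, 0) 1 = phaseState (uniformAmp n) :=
  (exists_prepareUniform n).choose_spec.1

theorem single_dotProduct_prepareUniform_mulVec (φ : Reg n 0 → ℝ) :
    Pi.single (0, false, 0) 1 ⬝ᵥ ((prepareUniform n).1 *ᵥ φ) = phaseState (uniformAmp n) ⬝ᵥ φ :=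
  (exists_prepareUniform n).choose_spec.2 φ

/-- The inversion about the mean. -/
noncomputable def diffusion (n : ℕ) [NeZero n] : Matrix.orthogonalGroup (Reg n 0) ℝ :=
  reflectionMatrix (phaseState (uniformAmp n)) phaseState_uniformAmp_dotProduct_self

theorem diffusion_mulVec (v : Fin n → ℝ) : (diffusion n).1 *ᵥ phaseState v =
    phaseState ((2 * (uniformAmp n ⬝ᵥ v)) • uniformAmp n - v) := by
  rw [diffusion, reflectionMatrix_mulVec, phaseState_dotProduct, phaseState_sub, phaseState_smul]

/-- Grover search with `m + 1` queries in which the preparation of the uniform state is undone at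
the end, so that an input without marked positions returns to the initial state. -/
noncomputable def groverTree (n : ℕ) [NeZero n] (m : ℕ) : QuantumTree n where
  work := 0
  first := prepareUniform n
  steps := List.replicate m (diffusion n) ++ [prepareUniform n]

theorem groverTree_queries (m : ℕ) : (groverTree n m).queries = m + 1 := by
  rw [QuantumTree.queries, groverTree, List.length_append, List.length_replicate,
    List.length_singleton]

theorem foldl_diffusion_const_false (m : ℕ) :
    (List.replicate m (diffusion n)).foldl (fun ψ U => U.1 *ᵥ queryOp (fun _ => false) ψ)
      (phaseState (uniformAmp n)) = phaseState (uniformAmp n) := by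
  induction m with
  | zero => rfl
  | succ m ih =>
    rw [List.replicate_succ, List.foldl_cons, queryOp_const_false, diffusion_mulVec,
      uniformAmp_dotProduct_self]
    convert ih using 3
    module

/-- Each Grover iteration rotates by `2θ` the plane spanned by the uniform vector and the marked
basis vector. The two identities are the coordinates along the uniform vector and orthogonal to it.
-/
theorem foldl_diffusion_unitInput (j : Fin n) {θ : ℝ} (hθ : Real.sin θ = (√(n : ℝ))⁻¹) (m : ℕ) :
    ∃ a b : ℝ, (List.replicate m (diffusion n)).foldl
        (fun ψ U => U.1 *ᵥ queryOp (unitInput j) ψ) (phaseState (uniformAmp n)) =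
        phaseState (a • uniformAmp n + b • Pi.single j 1) ∧
      a + Real.sin θ * b = Real.cos (m * (2 * θ)) ∧
      Real.cos θ * b = Real.sin (m * (2 * θ)) := by
  induction m with
  | zero => exact ⟨1, 0, by simp⟩
  | succ m ih =>
    obtain ⟨a, b, h, h1, h2⟩ := ih
    have hj : uniformAmp n j = Real.sin θ := by rw [hθ]; rfl
    have hdot : uniformAmp n ⬝ᵥ Pi.single j 1 = Real.sin θ := by simp [hj]
    refine ⟨a - 2 * Real.sin θ * (2 * a * Real.sin θ + b), 2 * a * Real.sin θ + b, ?_, ?_, ?_⟩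
    · rw [List.replicate_succ', List.foldl_append, h]
      simp only [List.foldl_cons, List.foldl_nil]
      rw [queryOp_phaseState, diffusion_mulVec]
      congr 1
      simp only [dotProduct_sub, dotProduct_add, dotProduct_smul, uniformAmp_dotProduct_self, hdot,
        Pi.add_apply, Pi.smul_apply, Pi.single_eq_same, hj, smul_eq_mul]
      module
    · rw [Nat.cast_succ, add_mul, one_mul, Real.cos_add, Real.sin_two_mul, Real.cos_two_mul, ← h1,
        ← h2, Real.cos_sq']
      linear_combination 2 * Real.sin θ * b * Real.sin_sq_add_cos_sq θ
    · rw [Nat.cast_succ, add_mul, one_mul, Real.sin_add, Real.sin_two_mul, Real.cos_two_mul, ← h1,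
        ← h2, Real.cos_sq']
      ring

/-- The measurement outcome that reports no marked position. -/
noncomputable def groverZero (n : ℕ) [NeZero n] (m : ℕ) : Reg n (groverTree n m).work := (0, false, 0)

theorem finalState_groverTree (m : ℕ) (x : Fin n → Bool) :
    (groverTree n m).finalState x (groverZero n m) =
      phaseState (uniformAmp n) ⬝ᵥ queryOp x ((List.replicate m (diffusion n)).foldl
        (fun ψ U => U.1 *ᵥ queryOp x ψ) (phaseState (uniformAmp n))) := by
  rw [← single_dotProduct_prepareUniform_mulVec, ← prepareUniform_mulVec_single,
    single_dotProduct, one_mul]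
  have h : (groverTree n m).finalState x =
      (List.replicate m (diffusion n) ++ [prepareUniform n]).foldl
      (fun ψ U => U.1 *ᵥ queryOp x ψ) ((prepareUniform n).1 *ᵥ Pi.single (0, false, 0) 1) := rfl
  rw [h, List.foldl_append]
  rfl

theorem outcomeProb_groverTree_const_false (m : ℕ) :
    (groverTree n m).outcomeProb (fun _ => false) (groverZero n m) = 1 := by
  rw [QuantumTree.outcomeProb, finalState_groverTree, foldl_diffusion_const_false,
    queryOp_const_false, phaseState_uniformAmp_dotProduct_self, one_pow]

/-- The diffusion fixes the uniform vector, so omitting it after the last query does not change the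
overlap `cos (2 (m + 1) θ)`. -/
theorem outcomeProb_groverTree_unitInput (m : ℕ) (j : Fin n) {θ : ℝ}
    (hθ : Real.sin θ = (√(n : ℝ))⁻¹) :
    (groverTree n m).outcomeProb (unitInput j) (groverZero n m) =
      1 - Real.sin ((m + 1 : ℕ) * (2 * θ)) ^ 2 := by
  obtain ⟨a, b, h, h1, h2⟩ := foldl_diffusion_unitInput j hθ m
  have hj : uniformAmp n j = Real.sin θ := by rw [hθ]; rfl
  have hdot : uniformAmp n ⬝ᵥ Pi.single j 1 = Real.sin θ := by simp [hj]
  rw [QuantumTree.outcomeProb, finalState_groverTree, h, queryOp_phaseState, phaseState_dotProduct,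
    ← Real.cos_sq']
  congr 1
  rw [Nat.cast_succ, add_mul, one_mul, Real.cos_add, Real.sin_two_mul, Real.cos_two_mul, ← h1, ← h2,
    Real.cos_sq']
  simp only [dotProduct_sub, dotProduct_add, dotProduct_smul, uniformAmp_dotProduct_self, hdot,
    Pi.add_apply, Pi.smul_apply, Pi.single_eq_same, hj, smul_eq_mul]
  linear_combination 2 * Real.sin θ * b * Real.sin_sq_add_cos_sq θ

end Grover

/-- The probability `sin² (2 t θ)` that Grover search with `t` queries detects a marked position is
at least `t² / n` as long as `t` is at most `√n / 2`. -/
theorem sq_div_le_sin_sq {n t : ℕ} (hn : 2 ≤ n) (ht : t = 1 ∨ 4 * t ^ 2 ≤ n) {θ : ℝ}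
    (h0 : 0 ≤ θ) (h1 : θ ≤ Real.pi / 2) (hθ : Real.sin θ = (√(n : ℝ))⁻¹) :
    (t : ℝ) ^ 2 / n ≤ Real.sin (t * (2 * θ)) ^ 2 := by
  have hn' : (2 : ℝ) ≤ n := by exact_mod_cast hn
  have hs : Real.sin θ ^ 2 = (n : ℝ)⁻¹ := by
    rw [hθ, inv_pow, Real.sq_sqrt (by linarith)]
  -- For `t = 1` the double-angle formula gives `4 (1/n) (1 - 1/n) ≥ 1/n`; this fails at `n = 1`,
  -- where `sin 2θ = 0`. Otherwise Jordan's inequality is used twice, first to get `2tθ ≤ π/2`.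
  rcases ht with rfl | ht
  · rw [Nat.cast_one, one_mul, Real.sin_two_mul, mul_pow, mul_pow, Real.cos_sq', hs]
    have h : (n : ℝ)⁻¹ ≤ 1 / 2 := by
      rw [one_div]
      gcongr
    have h' : 0 ≤ (n : ℝ)⁻¹ := by positivity
    rw [one_pow, one_div]
    nlinarith
  · have ht' : (2 * (t : ℝ)) ^ 2 ≤ n := by
      have : (4 * (t : ℝ) ^ 2) ≤ n := by exact_mod_cast ht
      linarith
    have hpi := Real.pi_pos
    have hr : 2 * (t : ℝ) ≤ √(n : ℝ) := Real.le_sqrt_of_sq_le ht'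
    have hr0 : 0 < √(n : ℝ) := Real.sqrt_pos.2 (by linarith)
    have h2 := Real.mul_le_sin h0 h1
    have hθs : θ ≤ Real.pi / 2 * (√(n : ℝ))⁻¹ := by
      rw [← hθ]
      calc θ = Real.pi / 2 * (2 / Real.pi * θ) := by field_simp
        _ ≤ _ := by gcongr
    have hθl : (√(n : ℝ))⁻¹ ≤ θ := hθ ▸ Real.sin_le h0
    have hle : t * (2 * θ) ≤ Real.pi / 2 := by
      calc (t : ℝ) * (2 * θ) = (2 * t) * θ := by ring
        _ ≤ √(n : ℝ) * (Real.pi / 2 * (√(n : ℝ))⁻¹) := by gcongr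
        _ = Real.pi / 2 := by field_simp
    have h3 := Real.mul_le_sin (by positivity : 0 ≤ t * (2 * θ)) hle
    have h4 : (t : ℝ) * (√(n : ℝ))⁻¹ ≤ Real.sin (t * (2 * θ)) := by
      refine le_trans ?_ h3
      have h5 : 1 ≤ 2 / Real.pi * 2 := by
        rw [div_mul_eq_mul_div, le_div_iff₀ hpi]
        linarith [Real.pi_le_four]
      calc (t : ℝ) * (√(n : ℝ))⁻¹ ≤ t * θ := by gcongr
        _ = 1 * (t * θ) := (one_mul _).symm
        _ ≤ (2 / Real.pi * 2) * (t * θ) := by gcongr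
        _ = _ := by ring
    calc (t : ℝ) ^ 2 / n = (t * (√(n : ℝ))⁻¹) ^ 2 := by
          rw [mul_pow, inv_pow, Real.sq_sqrt (by linarith), div_eq_mul_inv]
      _ ≤ _ := by gcongr

/-! ### Repeated Grover search as a hybrid tree -/

namespace HybridTree

variable {n : ℕ}

/-- Run `A` up to `k` times, answering `true` as soon as an outcome other than `p₀` is seen. -/
def repeatUntil (A : QuantumTree n) (p₀ : Reg n A.work) : ℕ → HybridTree n
  | 0 => leaf false
  | k + 1 => node A fun p => if p = p₀ then repeatUntil A p₀ k else leaf true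

theorem cost_repeatUntil_le (A : QuantumTree n) (p₀ : Reg n A.work) (k : ℕ) :
    (repeatUntil A p₀ k).cost ≤ k * A.queries := by
  induction k with
  | zero => simp [repeatUntil, cost]
  | succ k ih =>
    rw [repeatUntil, cost, Nat.succ_mul, add_comm]
    gcongr
    refine Finset.sup_le fun p _ => ?_
    split_ifs
    · exact ih
    · simp [cost]

theorem limited_repeatUntil (A : QuantumTree n) (p₀ : Reg n A.work) (k : ℕ) :
    (repeatUntil A p₀ k).Limited A.queries := by
  induction k with
  | zero => trivial
  | succ k ih =>
    refine ⟨le_rfl, fun p => ?_⟩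
    dsimp only
    split_ifs
    · exact ih
    · trivial

theorem outputProb_false_repeatUntil [NeZero n] (A : QuantumTree n) (p₀ : Reg n A.work)
    (x : Fin n → Bool) (k : ℕ) :
    (repeatUntil A p₀ k).outputProb x false = A.outcomeProb x p₀ ^ k := by
  induction k with
  | zero => simp [repeatUntil, outputProb]
  | succ k ih =>
    rw [repeatUntil, outputProb, Finset.sum_eq_single p₀, if_pos rfl, ih, pow_succ']
    · intro p _ hp
      simp [hp, outputProb]
    · simp

/-- A tree answering `false` on the zero input and `true` on the unit inputs with probability at
least `2/3` computes `PartialOr`. -/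
theorem computes_partialOr [NeZero n] {T : HybridTree n}
    (h0 : 2 / 3 ≤ T.outputProb (fun _ => false) false)
    (h1 : ∀ j, 2 / 3 ≤ T.outputProb (unitInput j) true) : T.Computes (partialOr n) := by
  rintro ⟨x, hx⟩
  by_cases h : ∃ j, x j = true
  · obtain ⟨j, hj⟩ := h
    have e : x = unitInput j := by
      funext i
      by_cases hi : i = j
      · simp [unitInput, hi, hj]
      · have : x i ≠ true := fun hxi =>
          hi (Finset.card_le_one.1 hx i (by simp [hxi]) j (by simp [hj]))
        simp [unitInput, hi, this]
    have e' : partialOr n ⟨x, hx⟩ = true := by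
      simpa [partialOr] using ⟨j, hj⟩
    rw [e']
    simpa [e] using h1 j
  · have e : x = fun _ => false := by
      funext i
      simpa using fun hi => h ⟨i, hi⟩
    have e' : partialOr n ⟨x, hx⟩ = false := by
      simpa [partialOr] using h
    rw [e']
    simpa [e] using h0

/-- One classical query computes `PartialOr` on a single bit. -/
theorem exists_computes_one :
    ∃ T : HybridTree 1, T.Limited 1 ∧ T.Computes (partialOr 1) ∧ T.cost = 1 := by
  let A : QuantumTree 1 := { work := 0, first := 1, steps := [1] }
  have key : ∀ (x : Fin 1 → Bool) (b : Bool), x 0 = b →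
      (node A fun p => leaf p.2.1).outputProb x b = 1 := by
    intro x b hb
    have hf : A.finalState x = Pi.single (0, b, 0) 1 := by
      have h := queryOp_single (w := 0) x 0 false 0
      simp only [QuantumTree.finalState, QuantumTree.initState, A, List.foldl_cons, List.foldl_nil,
        OneMemClass.coe_one, Matrix.one_mulVec]
      rw [h, hb]
      simp
    rw [outputProb, Finset.sum_eq_single (0, b, 0)]
    · simp [QuantumTree.outcomeProb, hf, outputProb]
    · intro p _ hp
      simp [QuantumTree.outcomeProb, hf, hp]
    · simp
  refine ⟨node A fun p => leaf p.2.1, ⟨le_rfl, fun _ => trivial⟩, computes_partialOr ?_ ?_, ?_⟩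
  · rw [key _ _ rfl]
    norm_num
  · intro j
    rw [key _ _ (by simp [unitInput, Subsingleton.elim j 0])]
    norm_num
  · simp [cost, QuantumTree.queries, A]

/-- Repeating Grover search with `t` queries about `2 n / t²` times computes `PartialOr`. -/
theorem exists_computes_grover {n : ℕ} [NeZero n] {t : ℕ} (hn : 2 ≤ n) (ht0 : 1 ≤ t)
    (ht : t = 1 ∨ 4 * t ^ 2 ≤ n) :
    ∃ T : HybridTree n, T.Limited t ∧ T.Computes (partialOr n) ∧
      (T.cost : ℝ) ≤ 2 * (n / t) + t := by
  obtain ⟨m, rfl⟩ : ∃ m, t = m + 1 := ⟨t - 1, by omega⟩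
  have hn1 : (1 : ℝ) ≤ n := by exact_mod_cast (by omega : 1 ≤ n)
  -- With detection probability at least `t²/n`, this many runs bring the error down to `e⁻² ≤ 1/3`.
  set R := ⌈2 * (n : ℝ) / ((m + 1 : ℕ) : ℝ) ^ 2⌉₊ with hR
  have hm0 : (0 : ℝ) < ((m + 1 : ℕ) : ℝ) := by positivity
  refine ⟨repeatUntil (groverTree n m) (groverZero n m) R, ?_, computes_partialOr ?_ fun j => ?_, ?_⟩
  · simpa only [groverTree_queries] using
      limited_repeatUntil (groverTree n m) (groverZero n m) R
  · rw [outputProb_false_repeatUntil, outcomeProb_groverTree_const_false, one_pow]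
    norm_num
  · have hσ0 : 0 ≤ (√(n : ℝ))⁻¹ := by positivity
    have hσ1 : (√(n : ℝ))⁻¹ ≤ 1 := inv_le_one_of_one_le₀ (Real.one_le_sqrt.2 hn1)
    have hθ := Real.sin_arcsin (by linarith : -1 ≤ (√(n : ℝ))⁻¹) hσ1
    have hd := sq_div_le_sin_sq hn ht (Real.arcsin_nonneg.2 hσ0) (Real.arcsin_le_pi_div_two _) hθ
    have hp := outcomeProb_groverTree_unitInput m j hθ
    have hp0 := (groverTree n m).outcomeProb_nonneg (unitInput j) (groverZero n m)
    have hsum := outputProb_true_add_false (unitInput j)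
      (repeatUntil (groverTree n m) (groverZero n m) R)
    rw [outputProb_false_repeatUntil] at hsum
    set s : ℝ := ((m + 1 : ℕ) : ℝ) ^ 2 / n with hs
    have h1 : (groverTree n m).outcomeProb (unitInput j) (groverZero n m) ≤ Real.exp (-s) := by
      linarith [Real.add_one_le_exp (-s)]
    have h2 : 2 ≤ R * s := by
      have h3 : 2 * (n : ℝ) / ((m + 1 : ℕ) : ℝ) ^ 2 ≤ R := Nat.le_ceil _
      calc (2 : ℝ) = 2 * (n : ℝ) / ((m + 1 : ℕ) : ℝ) ^ 2 * s := by rw [hs]; field_simp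
        _ ≤ R * s := by gcongr
    have h3 : (groverTree n m).outcomeProb (unitInput j) (groverZero n m) ^ R ≤ 1 / 3 := by
      calc _ ≤ Real.exp (-s) ^ R := by gcongr
        _ = (Real.exp (R * s))⁻¹ := by rw [← Real.exp_nat_mul, ← Real.exp_neg]; congr 1; ring
        _ ≤ 3⁻¹ := by
          gcongr
          linarith [Real.add_one_le_exp (R * s)]
        _ = 1 / 3 := by norm_num
    linarith
  · have h1 := cost_repeatUntil_le (groverTree n m) (groverZero n m) R
    rw [groverTree_queries] at h1
    have h2 : (R : ℝ) ≤ 2 * (n : ℝ) / ((m + 1 : ℕ) : ℝ) ^ 2 + 1 :=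
      (Nat.ceil_lt_add_one (by positivity)).le
    calc _ ≤ (R : ℝ) * ((m + 1 : ℕ) : ℝ) := by exact_mod_cast h1
      _ ≤ (2 * (n : ℝ) / ((m + 1 : ℕ) : ℝ) ^ 2 + 1) * ((m + 1 : ℕ) : ℝ) := by gcongr
      _ = _ := by field_simp

theorem exists_computes_partialOr (n : ℕ) [NeZero n] {q : ℕ} (hq : 1 ≤ q) :
    ∃ T : HybridTree n, T.Limited q ∧ T.Computes (partialOr n) ∧
      (T.cost : ℝ) ≤ 9 * ((n : ℝ) / q + √(n : ℝ)) := by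
  have hn0 : n ≠ 0 := NeZero.ne n
  have hq' : (0 : ℝ) < q := by exact_mod_cast hq
  rcases (by omega : n = 1 ∨ 2 ≤ n) with rfl | hn
  · obtain ⟨T, h1, h2, h3⟩ := exists_computes_one
    refine ⟨T, h1.mono hq, h2, ?_⟩
    rw [h3]
    have : 0 ≤ (q : ℝ)⁻¹ := by positivity
    norm_num
    linarith
  set s := Nat.sqrt n with hs
  -- About `√n / 2`, the largest useful number of queries in one run.
  set M := max 1 (s / 2) with hM
  have hs1 : s * s ≤ n := Nat.sqrt_le n
  have hs2 : n < (s + 1) * (s + 1) := Nat.lt_succ_sqrt n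
  have hM1 : 1 ≤ M := le_max_left _ _
  have hM4 : s + 1 ≤ 4 * M := by omega
  have hMs : M = 1 ∨ 2 * M ≤ s := by omega
  have ht : min q M = 1 ∨ 4 * min q M ^ 2 ≤ n := by
    rcases hMs with h | h
    · left; omega
    · right
      have h2 : 2 * min q M ≤ s := by omega
      have := Nat.mul_le_mul h2 h2
      nlinarith
  obtain ⟨T, h1, h2, h3⟩ := exists_computes_grover hn (by omega : 1 ≤ min q M) ht
  refine ⟨T, h1.mono (min_le_left _ _), h2, h3.trans ?_⟩
  have hM0 : (0 : ℝ) < M := by exact_mod_cast hM1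
  have hr1 : 1 ≤ √(n : ℝ) := Real.one_le_sqrt.2 (by exact_mod_cast (by omega : 1 ≤ n))
  have hsq := Real.sq_sqrt (Nat.cast_nonneg n : (0 : ℝ) ≤ n)
  have hr4 : √(n : ℝ) ≤ 4 * M := by
    refine Real.sqrt_le_iff.2 ⟨by positivity, ?_⟩
    have : n ≤ (4 * M) ^ 2 := by nlinarith
    exact_mod_cast this
  have hMr : (M : ℝ) ≤ √(n : ℝ) := by
    refine Real.le_sqrt_of_sq_le ?_
    have : M ^ 2 ≤ n := by
      rcases hMs with h | h
      · rw [h]; omega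
      · nlinarith
    exact_mod_cast this
  have hnM : (n : ℝ) / M ≤ 4 * √(n : ℝ) := by
    rw [div_le_iff₀ hM0]
    nlinarith
  have hnt : (n : ℝ) / (min q M : ℕ) ≤ n / q + 4 * √(n : ℝ) := by
    have : 0 ≤ (n : ℝ) / q := by positivity
    rcases min_choice q M with h | h <;> rw [h] <;> linarith
  have htr : ((min q M : ℕ) : ℝ) ≤ √(n : ℝ) :=
    le_trans (by exact_mod_cast min_le_right q M) hMr
  have : 0 ≤ (n : ℝ) / q := by positivity
  linarith

end HybridTree

/-! ### The two bounds combined -/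

theorem theorem2 :
    ∃ c C : ℝ, 0 < c ∧ 0 < C ∧ ∀ (n : ℕ) [NeZero n] (q : ℕ), 1 ≤ q →
      c * ((n : ℝ) / q + √(n : ℝ)) ≤ (hybridComplexity (partialOr n) q : ℝ) ∧
      (hybridComplexity (partialOr n) q : ℝ) ≤ C * ((n : ℝ) / q + √(n : ℝ)) := by
  refine ⟨1 / 2592, 9, by norm_num, by norm_num, fun n _ q hq => ?_⟩
  obtain ⟨T, h1, h2, h3⟩ := HybridTree.exists_computes_partialOr n hq
  constructor
  -- The tree from the upper bound shows that the infimum is attained rather than the default value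
  -- `0`.
  · obtain ⟨S, hS, hSc, hcost⟩ := Nat.sInf_mem (s := {c : ℕ | ∃ T : HybridTree n, T.Limited q ∧
      T.Computes (partialOr n) ∧ T.cost = c}) ⟨T.cost, T, h1, h2, rfl⟩
    rw [hybridComplexity, ← hcost]
    have hq' : (0 : ℝ) < q := by exact_mod_cast hq
    have hn : (n : ℝ) / q ≤ 1296 * S.cost := by
      rw [div_le_iff₀ hq']
      linarith [HybridTree.Computes.le_mul_cost hS hSc]
    -- The same lower bound with `q` replaced by the cost of `S`.
    have hr : √(n : ℝ) ≤ 36 * S.cost :=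
      Real.sqrt_le_iff.2 ⟨by positivity,
        (HybridTree.Computes.le_mul_cost S.limited_cost hSc).trans_eq (by ring)⟩
    have : (0 : ℝ) ≤ S.cost := Nat.cast_nonneg _
    linarith
  · refine le_trans (Nat.cast_le.2 ?_) h3
    exact Nat.sInf_le ⟨T, h1, h2, rfl⟩
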